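/- For every $n$ let $A,Y\in\{0,1\}^{n\times n}$ be independent random symmetric matrices with zero diagonal, $A\sim\mathrm{ER}(p_n)$ and $Y\sim\mathrm{ER}(q_n)$ with $p_n,q_n\in(0,1)$, i.e. the entries $A_{ij}$, $i>j$, are independent with $\mathbb P(A_{ij}=1)=p_n$, and likewise for $Y$ with $q_n$. Let $P\in\mathbb R^{n\times n}$ be the matrix of the linear model, $P_{ij}=\theta_0^\ast+\theta_1^\ast A_{ij}+\theta_2^\ast Y_{ij}$ for $i\ne j$ and $P_{ii}=0$, where the coefficients $\theta_0^\ast,\theta_1^\ast,\theta_2^\ast\in\mathbb R$ may depend on $n$ and are such that $\theta_0^\ast+\theta_1^\ast a+\theta_2^\ast b\in[0,1]$ for all $a,b\in\{0,1\}$ (so that a graph $B$ with $B_{ij}\mid A,Y\sim\mathrm{Ber}(P_{ij})$ makes sense). Let $\mathcal S\subset[n]$ be a nonempty deterministic set of seeds, $s=|\mathcal S|$, which may depend on $n$. For an $n\times n$ permutation matrix $Q$ let $\mathcal K=\{i:Q_{ii}=0\}$, $k=|\mathcal K|$, $\mathcal Q=\{(i,j)\in[n]^2: i>j,\ i\in\mathcal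 K\text{ or }j\in\mathcal K\}$ and $M_P(Q)=\|P-QPQ^\top\|_F^2$. Put $\tau_n=\min\{p_n,q_n\}$ and let $\delta>0$. There is a constant $\alpha_2>0$ depending only on $\delta$, and for every $\alpha_1>0$ there is a constant $c>0$ depending only on $\delta$ and $\alpha_1$, such that the following holds for every $\alpha_3>0$, with $c_2^\ast=c\,\alpha_3$. If $p_n,q_n\le 1-\delta\tau_n$ and $$\text{(i)}\ \ \theta_0^\ast+\theta_1^\ast p_n+\theta_2^\ast q_n\ \ge\ \alpha_1\frac{\log n}{n},\qquad \text{(ii)}\ \ \frac{\tau_n^2}{p_n+q_n}\ \ge\ \alpha_2\frac{\log n}{n},$$ $$\text{(iii)}\ \ {\theta_1^\ast}^2+{\theta_2^\ast}^2\ \ge\ \alpha_3\max\left\{\frac{\log n}{\tau_n n},\ \frac{\sqrt{\log s}\,(\theta_0^\ast+\theta_1^\ast p_n+\theta_2^\ast q_n)}{\tau_n^{3/2}s}\right\}$$ for all sufficiently large $n$, then with probability $1-o(1)$ as $n\to\infty$, simultaneously for every $n\times n$ permutation matrix $Q$ with $Q_{ii}=1$ for all $i\in\mathcal S$, $$M_P(Q)\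 \ge\ c_2^\ast\max\left\{k\log n,\ \frac{\sqrt{\log s}}{\tau_n^{1/2}s}\sum_{(i,j)\in\mathcal Q}P_{ij}\right\}.$$ In particular, $c_2^\ast>0$ can be prescribed arbitrarily if $\alpha_3$ is chosen large enough in terms of $c_2^\ast$, $\delta$ and $\alpha_1$. -/

import Mathlib

open MeasureTheory ProbabilityTheory Filter Topology

noncomputable section

/-- The random matrix `A` on the probability space `(Ω, μ)` is distributed according to the
Erdős–Rényi model `ER(p)` on `n` vertices: it is the adjacency matrix of a simple undirected
graph, and the entries below the diagonal are independent and equal to `1` with probability `p`. -/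
structure IsErdosRenyi {Ω : Type*} [MeasurableSpace Ω] (μ : Measure Ω) {n : ℕ}
    (A : Ω → Matrix (Fin n) (Fin n) ℝ) (p : ℝ) : Prop where
  isAdjMatrix : ∀ ω, (A ω).IsAdjMatrix
  measurable_entry : ∀ i j, Measurable fun ω => A ω i j
  prob_edge : ∀ i j, j < i → μ {ω | A ω i j = 1} = ENNReal.ofReal p
  indep_edges : iIndepFun
    (fun (e : {e : Fin n × Fin n // e.2 < e.1}) (ω : Ω) => A ω e.1.1 e.1.2) μ

/-- The matrix `P` of the linear model with identity link: `P i j = θ₀ + θ₁ A i j + θ₂ Y i j` off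
the diagonal, and `P i i = 0`. -/
def edgeProb {n : ℕ} (θ₀ θ₁ θ₂ : ℝ) (A Y : Matrix (Fin n) (Fin n) ℝ) :
    Matrix (Fin n) (Fin n) ℝ :=
  Matrix.of fun i j => if i = j then 0 else θ₀ + θ₁ * A i j + θ₂ * Y i j

open scoped Matrix Matrix.Norms.Frobenius in
/-- `M_P(Q) = ‖P - Q P Qᵀ‖_F ^ 2`, with the Frobenius norm. -/
def mismatch {n : ℕ} (P Q : Matrix (Fin n) (Fin n) ℝ) : ℝ :=
  ‖P - Q * P * Qᵀ‖ ^ 2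

open scoped Classical in
/-- The set `𝒦` of the labels permuted by the permutation matrix `Q`. -/
def movedLabels {n : ℕ} (Q : Matrix (Fin n) (Fin n) ℝ) : Finset (Fin n) :=
  Finset.univ.filter fun i => Q i i = 0

/-- The set `𝒬` of the pairs `(i, j)` with `i > j`, one of whose labels is permuted by `Q`. -/
def movedPairs {n : ℕ} (Q : Matrix (Fin n) (Fin n) ℝ) : Finset (Fin n × Fin n) :=
  Finset.univ.filter fun e => (e.1 ∈ movedLabels Q ∨ e.2 ∈ movedLabels Q) ∧ e.2 < e.1

/-- The signal condition with constant `c` and parameter `L`: every permutation matrix `Q` that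
fixes all the seeds satisfies
`M_P(Q) ≥ c max {k log n, (√(log s) / (√L s)) ∑_{(i,j) ∈ 𝒬} P i j}`,
where `k` is the number of labels permuted by `Q` and `s` is the number of seeds. -/
def SignalCondition {n : ℕ} (c L : ℝ) (S : Finset (Fin n)) (P : Matrix (Fin n) (Fin n) ℝ) : Prop :=
  ∀ σ : Equiv.Perm (Fin n), (∀ i ∈ S, σ.permMatrix ℝ i i = 1) →
    c * max (((movedLabels (σ.permMatrix ℝ)).card : ℝ) * Real.log n)
        (√(Real.log S.card) / (√L * S.card) * ∑ e ∈ movedPairs (σ.permMatrix ℝ), P e.1 e.2)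
      ≤ mismatch P (σ.permMatrix ℝ)

end

/-! Call a pair (i, j) an A-flip of σ if σ changes the entry of A there but not that of Y. At an
A-flip the entry of P changes by ±θ₁, at a Y-flip by ±θ₂, and no cancellation between the two
coefficients is possible. Hence M_P(Q) is at least θ₁² times the number of A-flips, and at least θ₂²
times the number of Y-flips. Averaging the two bounds produces θ₁² + θ₂², the quantity bounded below
in (iii).

So it suffices that, with high probability, every σ ≠ 1 moving k labels has at least of order kτn
flips of both kinds. For fixed σ, a set U of at least k/6 labels and a set J of at least n/3 labels
are chosen so that the pairs in U × J and their images under σ are all distinct edges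
(`exists_many_disjoint_pairs`). The flip indicators on U × J are then independent with mean at least
p(1 - p), and a Chernoff bound gives failure probability exp(-p(1 - p)kn/72) (`prob_flipCount_le`).
Condition (ii) makes this at most n^(-3k), which beats the number of permutations moving k labels
(`sum_perm_pow_card_support_le`).

The sum of P over 𝒬 is at most k times the largest row sum of P. By a Chernoff bound and (i), all
row sums are at most C n m with C = 2 + 2/α₁ (`prob_exists_le_sum_edgeProb`). On the intersection of
these events the claim is deterministic (`signalCondition_of_flipCount`). -/

noncomputable section

/-! ### Independence of families of pairs -/

section Independence

variable {Ω ι : Type*} [MeasurableSpace Ω] {μ : Measure Ω}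

/-- Two independent families, each consisting of independent variables, give an independent family
of pairs. -/
lemma ProbabilityTheory.iIndepFun.prodMk_of_indepFun [Fintype ι] {α β : Type*}
    [MeasurableSpace α] [MeasurableSpace β] {f : ι → Ω → α} {g : ι → Ω → β}
    (hf : iIndepFun f μ) (hg : iIndepFun g μ) (mf : ∀ i, Measurable (f i))
    (mg : ∀ i, Measurable (g i))
    (hfg : IndepFun (fun ω i => f i ω) (fun ω i => g i ω) μ) :
    iIndepFun (fun i ω => (f i ω, g i ω)) μ := by
  have := hf.isProbabilityMeasure
  have hpf : ∀ i, IsProbabilityMeasure (μ.map (f i)) :=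
    fun i => Measure.isProbabilityMeasure_map (mf i).aemeasurable
  have hpg : ∀ i, IsProbabilityMeasure (μ.map (g i)) :=
    fun i => Measure.isProbabilityMeasure_map (mg i).aemeasurable
  have mf' : Measurable fun ω i => f i ω := measurable_pi_lambda _ mf
  have mg' : Measurable fun ω i => g i ω := measurable_pi_lambda _ mg
  rw [iIndepFun_iff_map_fun_eq_pi_map fun i => ((mf i).prodMk (mg i)).aemeasurable]
  have hpair : ∀ i, μ.map (fun ω => (f i ω, g i ω)) = (μ.map (f i)).prod (μ.map (g i)) := by
    intro i
    have : IndepFun (f i) (g i) μ := hfg.comp (measurable_pi_apply i) (measurable_pi_apply i)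
    exact (indepFun_iff_map_prod_eq_prod_map_map (mf i).aemeasurable (mg i).aemeasurable).1 this
  have hmp := measurePreserving_arrowProdEquivProdArrow α β ι (fun i => μ.map (f i))
    (fun i => μ.map (g i))
  -- After regrouping a family of pairs as a pair of families, both laws are the product of the law
  -- of f and the law of g; regrouping is a measurable equivalence, so it can be undone.
  have key : (μ.map (fun ω i => (f i ω, g i ω))).map
      (MeasurableEquiv.arrowProdEquivProdArrow α β ι) =
      (Measure.pi fun i => (μ.map (f i)).prod (μ.map (g i))).map
        (MeasurableEquiv.arrowProdEquivProdArrow α β ι) := by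
    rw [hmp.map_eq, Measure.map_map (MeasurableEquiv.measurable _) (by fun_prop),
      ← hf.map_fun_eq_pi_map fun i => (mf i).aemeasurable,
      ← hg.map_fun_eq_pi_map fun i => (mg i).aemeasurable,
      ← (indepFun_iff_map_prod_eq_prod_map_map mf'.aemeasurable mg'.aemeasurable).1 hfg]
    rfl
  simp_rw [hpair]
  exact (MeasurableEquiv.arrowProdEquivProdArrow α β ι).map_measurableEquiv_injective key

/-- Disjoint pairs of members of an independent family form an independent family. -/
lemma ProbabilityTheory.iIndepFun.prodMk_precomp [Fintype ι] {κ α : Type*} [MeasurableSpace α]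
    {f : κ → Ω → α} (hf : iIndepFun f μ) (mf : ∀ i, Measurable (f i)) {a b : ι → κ}
    (ha : a.Injective) (hb : b.Injective) (hab : ∀ i j, a i ≠ b j) :
    iIndepFun (fun i ω => (f (a i) ω, f (b i) ω)) μ := by
  classical
  refine (hf.precomp ha).prodMk_of_indepFun (hf.precomp hb) (fun i => mf _) (fun i => mf _) ?_
  have hdis : Disjoint (Finset.univ.image a) (Finset.univ.image b) := by
    rw [Finset.disjoint_left]
    simp only [Finset.mem_image, Finset.mem_univ, true_and]
    rintro _ ⟨i, rfl⟩ ⟨j, hj⟩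
    exact hab i j hj.symm
  have := hf.indepFun_finset _ _ hdis mf
  exact this.comp
    (φ := fun u (i : ι) => u ⟨a i, Finset.mem_image_of_mem _ (Finset.mem_univ _)⟩)
    (ψ := fun u (i : ι) => u ⟨b i, Finset.mem_image_of_mem _ (Finset.mem_univ _)⟩)
    (by fun_prop) (by fun_prop)

end Independence

/-! ### Chernoff bounds for independent variables with values in [0, 1] -/

section Chernoff

variable {Ω ι : Type*} [MeasurableSpace Ω] {μ : Measure Ω} [IsProbabilityMeasure μ]

lemma integrable_of_mem_Icc {X : Ω → ℝ} (hX : Measurable X) (h01 : ∀ ω, X ω ∈ Set.Icc (0 : ℝ) 1) :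
    Integrable X μ :=
  Integrable.of_bound hX.aestronglyMeasurable 1
    (ae_of_all _ fun ω => by rw [Real.norm_eq_abs, abs_of_nonneg (h01 ω).1]; exact (h01 ω).2)

/-- An affine majorant of the exponential on [0, 1] makes the moment generating function depend on
the mean alone; 1 + y ≤ exp y then makes it multiplicative over sums. -/
lemma mgf_le_exp_of_le_affine {X : Ω → ℝ} (hX : Measurable X)
    (h01 : ∀ ω, X ω ∈ Set.Icc (0 : ℝ) 1) {t a : ℝ}
    (hta : ∀ x ∈ Set.Icc (0 : ℝ) 1, Real.exp (t * x) ≤ 1 + a * x) :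
    mgf X μ t ≤ Real.exp (a * ∫ ω, X ω ∂μ) := by
  have hi := integrable_of_mem_Icc (μ := μ) hX h01
  calc mgf X μ t ≤ ∫ ω, (1 + a * X ω) ∂μ := by
        refine integral_mono_of_nonneg (ae_of_all _ fun ω => (Real.exp_pos _).le)
          ((integrable_const _).add (hi.const_mul a)) (ae_of_all _ fun ω => hta _ (h01 ω))
    _ = a * (∫ ω, X ω ∂μ) + 1 := by
        rw [integral_add (integrable_const _) (hi.const_mul a), integral_const_mul]
        simp [add_comm]
    _ ≤ _ := Real.add_one_le_exp _

lemma integrable_exp_mul_sum {X : ι → Ω → ℝ} (hX : ∀ i, Measurable (X i))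
    (h01 : ∀ i ω, X i ω ∈ Set.Icc (0 : ℝ) 1) (s : Finset ι) (t : ℝ) :
    Integrable (fun ω => Real.exp (t * (∑ i ∈ s, X i) ω)) μ := by
  refine Integrable.of_bound (C := Real.exp (|t| * s.card))
    (by fun_prop) (ae_of_all _ fun ω => ?_)
  rw [Real.norm_eq_abs, Real.abs_exp, Real.exp_le_exp, Finset.sum_apply]
  have h0 : 0 ≤ ∑ i ∈ s, X i ω := Finset.sum_nonneg fun i _ => (h01 i ω).1
  have h1 : ∑ i ∈ s, X i ω ≤ s.card := by
    simpa using Finset.sum_le_sum fun i (_ : i ∈ s) => (h01 i ω).2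
  exact mul_le_mul (le_abs_self t) h1 h0 (abs_nonneg t)

lemma mgf_sum_le_exp_of_le_affine {X : ι → Ω → ℝ} (hind : iIndepFun X μ)
    (hX : ∀ i, Measurable (X i)) (h01 : ∀ i ω, X i ω ∈ Set.Icc (0 : ℝ) 1) (s : Finset ι) {t a : ℝ}
    (hta : ∀ x ∈ Set.Icc (0 : ℝ) 1, Real.exp (t * x) ≤ 1 + a * x) :
    mgf (∑ i ∈ s, X i) μ t ≤ Real.exp (a * ∑ i ∈ s, ∫ ω, X i ω ∂μ) := by
  rw [hind.mgf_sum hX, Finset.mul_sum, Real.exp_sum]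
  exact Finset.prod_le_prod (fun i _ => mgf_nonneg)
    fun i _ => mgf_le_exp_of_le_affine (hX i) (h01 i) hta

/-- A lower tail bound of Chernoff type. -/
lemma measureReal_sum_le_le_exp {X : ι → Ω → ℝ} (hind : iIndepFun X μ)
    (hX : ∀ i, Measurable (X i)) (h01 : ∀ i ω, X i ω ∈ Set.Icc (0 : ℝ) 1) (s : Finset ι) {r : ℝ}
    (hr : ∀ i ∈ s, r ≤ ∫ ω, X i ω ∂μ) :
    μ.real {ω | ∑ i ∈ s, X i ω ≤ r * s.card / 4} ≤ Real.exp (-(r * s.card / 4)) := by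
  -- With t = -1 and slope -1/2 the exponent is at most rN/4 - rN/2 = -rN/4, where N is the number
  -- of summands.
  have hexp : ∀ x ∈ Set.Icc (0 : ℝ) 1, Real.exp (-1 * x) ≤ 1 + (-1 / 2) * x := by
    rintro x ⟨h0, h1⟩
    rw [neg_one_mul, Real.exp_neg]
    have h2 := Real.add_one_le_exp x
    rw [inv_le_iff_one_le_mul₀ (Real.exp_pos x)]
    nlinarith [mul_nonneg h0 (sub_nonneg.2 h1)]
  have h := measure_le_le_exp_mul_mgf (μ := μ) (X := ∑ i ∈ s, X i) (r * s.card / 4)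
    (t := -1) (by norm_num) (integrable_exp_mul_sum hX h01 s _)
  have h2 := mgf_sum_le_exp_of_le_affine hind hX h01 s hexp
  have h3 : r * s.card ≤ ∑ i ∈ s, ∫ ω, X i ω ∂μ := by
    have := Finset.sum_le_sum hr
    simpa [mul_comm] using this
  simp only [Finset.sum_apply] at h
  refine (h.trans (mul_le_mul_of_nonneg_left h2 (Real.exp_pos _).le)).trans ?_
  rw [← Real.exp_add, Real.exp_le_exp]
  linarith

/-- An upper tail bound of Chernoff type. -/
lemma measureReal_le_sum_le_exp {X : ι → Ω → ℝ} (hind : iIndepFun X μ)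
    (hX : ∀ i, Measurable (X i)) (h01 : ∀ i ω, X i ω ∈ Set.Icc (0 : ℝ) 1) (s : Finset ι) {M : ℝ}
    (hM : ∑ i ∈ s, ∫ ω, X i ω ∂μ ≤ M) (b : ℝ) :
    μ.real {ω | b ≤ ∑ i ∈ s, X i ω} ≤ Real.exp (2 * M - b) := by
  have hexp : ∀ x ∈ Set.Icc (0 : ℝ) 1, Real.exp (1 * x) ≤ 1 + 2 * x := by
    rintro x ⟨h0, h1⟩
    have := Real.abs_exp_sub_one_le (x := x) (by rwa [abs_of_nonneg h0])
    rw [abs_of_nonneg h0] at this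
    rw [one_mul]
    linarith [le_abs_self (Real.exp x - 1)]
  have h := measure_ge_le_exp_mul_mgf (μ := μ) (X := ∑ i ∈ s, X i) b
    (t := 1) (by norm_num) (integrable_exp_mul_sum hX h01 s _)
  have h2 := mgf_sum_le_exp_of_le_affine hind hX h01 s hexp
  simp only [Finset.sum_apply] at h
  refine (h.trans (mul_le_mul_of_nonneg_left h2 (Real.exp_pos _).le)).trans ?_
  rw [← Real.exp_add, Real.exp_le_exp]
  linarith

end Chernoff

/-! ### Combinatorics of the moved points of a permutation -/

section Combinatorics

/-- The generating function of the number of moved points of a permutation. -/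
lemma sum_perm_pow_card_support_le {α : Type*} [Fintype α] [DecidableEq α] {x : ℝ} (hx : 0 ≤ x) :
    ∑ σ : Equiv.Perm α, x ^ σ.support.card ≤ (1 + Fintype.card α * x) ^ Fintype.card α := by
  have h1 : ∀ σ : Equiv.Perm α,
      x ^ σ.support.card = ∏ i, (if σ i = i then 1 else x) := by
    intro σ
    rw [Finset.prod_ite]
    simp [Equiv.Perm.support]
  calc ∑ σ : Equiv.Perm α, x ^ σ.support.card
      = ∑ σ : Equiv.Perm α, ∏ i, (if σ i = i then 1 else x) := Finset.sum_congr rfl fun σ _ => h1 σ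
    _ = ∑ f ∈ (Finset.univ : Finset (Equiv.Perm α)).map
          (⟨fun σ i => σ i, DFunLike.coe_injective⟩ : Equiv.Perm α ↪ (α → α)),
          ∏ i, (if f i = i then 1 else x) := by rw [Finset.sum_map]; rfl
    -- Enlarging the sum from permutations to all self-maps lets it factor over the points.
    _ ≤ ∑ f : α → α, ∏ i, (if f i = i then 1 else x) := by
        refine Finset.sum_le_sum_of_subset_of_nonneg (Finset.subset_univ _) fun f _ _ => ?_
        exact Finset.prod_nonneg fun i _ => by split_ifs <;> positivity
    _ = ∏ i : α, ∑ j : α, (if j = i then 1 else x) := by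
        rw [Finset.prod_univ_sum]; simp
    _ ≤ ∏ i : α, (1 + Fintype.card α * x) := by
        refine Finset.prod_le_prod (fun i _ => Finset.sum_nonneg fun j _ => by
          split_ifs <;> positivity) fun i _ => ?_
        calc ∑ j : α, (if j = i then 1 else x) ≤ ∑ j : α, ((if j = i then 1 else 0) + x) :=
              Finset.sum_le_sum fun j _ => by split_ifs <;> linarith
          _ = _ := by simp [Finset.sum_add_distrib]
    _ = _ := by simp

/-- A permutation moves a third of its support to a disjoint set. -/
lemma exists_subset_support_disjoint {α : Type*} [Fintype α] [DecidableEq α]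
    (σ : Equiv.Perm α) :
    ∃ U ⊆ σ.support, (∀ x ∈ U, σ x ∉ U) ∧ σ.support.card ≤ 3 * U.card := by
  obtain ⟨U, hU, hmax⟩ := Finset.exists_max_image
    (σ.support.powerset.filter fun U => ∀ x ∈ U, σ x ∉ U) Finset.card ⟨∅, by simp⟩
  simp only [Finset.mem_filter, Finset.mem_powerset] at hU hmax
  refine ⟨U, hU.1, hU.2, ?_⟩
  -- By maximality of U, a moved point outside U cannot be added, so its image or its preimage lies
  -- in U.
  have hsub : σ.support ⊆ U ∪ (U.image σ ∪ U.image σ.symm) := by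
    intro x hx
    by_contra hx'
    simp only [Finset.mem_union, Finset.mem_image, not_or, not_exists, not_and] at hx'
    obtain ⟨h1, h2, h3⟩ := hx'
    have := hmax (insert x U) ⟨Finset.insert_subset hx hU.1, ?_⟩
    · rw [Finset.card_insert_of_notMem h1] at this
      omega
    · intro y hy hy'
      rw [Finset.mem_insert] at hy hy'
      rcases hy with rfl | hy
      · rcases hy' with h | h
        · exact Equiv.Perm.mem_support.1 hx h
        · exact h3 _ h (by simp)
      · rcases hy' with h | h
        · exact h2 _ hy h
        · exact hU.2 _ hy h
  have h1 := Finset.card_le_card hsub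
  have h2 := Finset.card_union_le U (U.image σ ∪ U.image σ.symm)
  have h3 := Finset.card_union_le (U.image σ) (U.image σ.symm)
  have h4 := Finset.card_image_le (s := U) (f := σ)
  have h5 := Finset.card_image_le (s := U) (f := σ.symm)
  omega

/-- There are many pairs `(x, y)` with `x` in a set `U` which `y`, `σ x` and `σ y` avoid. -/
lemma exists_many_disjoint_pairs {n : ℕ} (hn : 15 ≤ n) (σ : Equiv.Perm (Fin n)) :
    ∃ U J : Finset (Fin n), (∀ x ∈ U, σ x ∉ U) ∧ (∀ y ∈ J, y ∉ U ∧ σ y ∉ U) ∧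
      σ.support.card * n ≤ 18 * (U.card * J.card) := by
  obtain ⟨V, hV, hVσ, hcard⟩ := exists_subset_support_disjoint σ
  -- The set V may contain half of all labels, and then V and its preimage could leave nothing for
  -- J. Trimming to about a sixth of the support keeps a third of the labels available; 18 = 6 · 3.
  obtain ⟨U, hUV, hUc⟩ := Finset.exists_subset_card_eq
    (show (σ.support.card + 5) / 6 ≤ V.card by omega)
  refine ⟨U, (U ∪ U.image σ.symm)ᶜ, fun x hx h => hVσ x (hUV hx) (hUV h), ?_, ?_⟩
  · intro y hy
    simp only [Finset.mem_compl, Finset.mem_union, Finset.mem_image, not_or, not_exists,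
      not_and] at hy
    exact ⟨hy.1, fun h => hy.2 _ h (by simp)⟩
  · have h2 := Finset.card_union_le U (U.image σ.symm)
    have h5 := Finset.card_image_le (s := U) (f := σ.symm)
    have h6 : σ.support.card ≤ n := by simpa using Finset.card_le_univ σ.support
    have h7 : n ≤ 3 * (U ∪ U.image σ.symm)ᶜ.card := by
      rw [Finset.card_compl, Fintype.card_fin]
      omega
    calc σ.support.card * n ≤ (6 * U.card) * (3 * (U ∪ U.image σ.symm)ᶜ.card) :=
          Nat.mul_le_mul (by omega) h7
      _ = _ := by ring

end Combinatorics

/-! ### Unordered edges -/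

section Edges

variable {n : ℕ}

/-- The pairs `(i, j)` with `j < i`, which index the possible edges of a graph. -/
abbrev EdgeIndex (n : ℕ) : Type := {e : Fin n × Fin n // e.2 < e.1}

/-- The possible edge joining two distinct vertices. -/
def edgeIndex (i j : Fin n) (h : i ≠ j) : EdgeIndex n := ⟨(max i j, min i j), min_lt_max.2 h⟩

lemma edgeIndex_eq_iff {i j k l : Fin n} (h : i ≠ j) (h' : k ≠ l) :
    edgeIndex i j h = edgeIndex k l h' ↔ (i = k ∧ j = l) ∨ (i = l ∧ j = k) := by
  simp only [edgeIndex, Subtype.mk.injEq, Prod.mk.injEq]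
  constructor
  · intro hh
    rcases le_total i j with h1 | h1 <;> rcases le_total k l with h2 | h2 <;>
      simp only [h1, h2, max_eq_left, max_eq_right, min_eq_left, min_eq_right] at hh <;> tauto
  · rintro (⟨rfl, rfl⟩ | ⟨rfl, rfl⟩)
    · simp
    · exact ⟨max_comm _ _, min_comm _ _⟩

lemma Matrix.IsAdjMatrix.apply_edgeIndex {M : Matrix (Fin n) (Fin n) ℝ} (hM : M.IsAdjMatrix)
    (i j : Fin n) (h : i ≠ j) : M (edgeIndex i j h).1.1 (edgeIndex i j h).1.2 = M i j := by
  rcases le_total i j with h1 | h1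
  · simpa [edgeIndex, h1] using hM.symm.apply i j
  · simp [edgeIndex, h1]

end Edges

/-! ### Variables with values in {0, 1} -/

section ZeroOne

variable {Ω : Type*} [MeasurableSpace Ω] {μ : Measure Ω} {X Z : Ω → ℝ}

lemma integral_eq_measureReal_eq_one (hX : Measurable X) (h01 : ∀ ω, X ω = 0 ∨ X ω = 1) :
    ∫ ω, X ω ∂μ = μ.real {ω | X ω = 1} := by
  have h1 : X = {ω | X ω = 1}.indicator 1 := by
    ext ω
    rcases h01 ω with h | h <;> simp [Set.indicator, h]
  conv_lhs => rw [h1]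
  exact integral_indicator_one (hX (measurableSet_singleton 1))

lemma ProbabilityTheory.IndepFun.integral_sq_sub_eq [IsProbabilityMeasure μ]
    (hind : IndepFun X Z μ) (hX : Measurable X) (hZ : Measurable Z) (hX01 : ∀ ω, X ω = 0 ∨ X ω = 1) (hZ01 : ∀ ω, Z ω = 0 ∨ Z ω = 1) :
    ∫ ω, (X ω - Z ω) ^ 2 ∂μ =
      ∫ ω, X ω ∂μ + ∫ ω, Z ω ∂μ - 2 * ((∫ ω, X ω ∂μ) * ∫ ω, Z ω ∂μ) := by
  have iX : Integrable X μ := integrable_of_mem_Icc hX fun ω => by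
    rcases hX01 ω with h | h <;> simp [h]
  have iZ : Integrable Z μ := integrable_of_mem_Icc hZ fun ω => by
    rcases hZ01 ω with h | h <;> simp [h]
  have iXZ : Integrable (fun ω => X ω * Z ω) μ := integrable_of_mem_Icc (hX.mul hZ) fun ω => by
    rcases hX01 ω with h | h <;> rcases hZ01 ω with h' | h' <;> simp [h, h']
  have h1 : ∀ ω, (X ω - Z ω) ^ 2 = X ω + Z ω - 2 * (X ω * Z ω) := by
    intro ω
    rcases hX01 ω with h | h <;> rcases hZ01 ω with h' | h' <;> norm_num [h, h']
  simp_rw [h1]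
  rw [integral_sub (f := fun ω => X ω + Z ω) (iX.add iZ) (iXZ.const_mul 2), integral_add iX iZ, integral_const_mul,
    hind.integral_fun_mul_eq_mul_integral iX.aestronglyMeasurable iZ.aestronglyMeasurable]

lemma integrable_sq_sub [IsProbabilityMeasure μ] (hX : Measurable X)
    (hZ : Measurable Z) (hX01 : ∀ ω, X ω = 0 ∨ X ω = 1) (hZ01 : ∀ ω, Z ω = 0 ∨ Z ω = 1) :
    Integrable (fun ω => (X ω - Z ω) ^ 2) μ :=
  integrable_of_mem_Icc (by fun_prop) fun ω => by
    rcases hX01 ω with h | h <;> rcases hZ01 ω with h' | h' <;> norm_num [h, h']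

end ZeroOne

/-! ### Flip counts and row sums for Erdős–Rényi graphs -/

section ErdosRenyi

variable {Ω : Type*} [MeasurableSpace Ω] {μ : Measure Ω} {n : ℕ}
  {A Y : Ω → Matrix (Fin n) (Fin n) ℝ} {p q : ℝ}

namespace IsErdosRenyi

lemma entry_mem_Icc (hA : IsErdosRenyi μ A p) (ω : Ω) (i j : Fin n) :
    A ω i j ∈ Set.Icc (0 : ℝ) 1 := by
  rcases (hA.isAdjMatrix ω).zero_or_one i j with h | h <;> simp [h]

lemma integrable_entry [IsProbabilityMeasure μ] (hA : IsErdosRenyi μ A p) (i j : Fin n) :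
    Integrable (fun ω => A ω i j) μ :=
  integrable_of_mem_Icc (hA.measurable_entry i j) fun ω => hA.entry_mem_Icc ω i j

lemma integral_edge [IsProbabilityMeasure μ] (hA : IsErdosRenyi μ A p) (hp : 0 ≤ p) (e : EdgeIndex n) :
    ∫ ω, A ω e.1.1 e.1.2 ∂μ = p := by
  refine (integral_eq_measureReal_eq_one (hA.measurable_entry _ _)
    fun ω => (hA.isAdjMatrix ω).zero_or_one _ _).trans ?_
  rw [Measure.real, hA.prob_edge _ _ e.2, ENNReal.toReal_ofReal hp]

lemma integral_sq_sub_edge [IsProbabilityMeasure μ] (hA : IsErdosRenyi μ A p) (hp : 0 ≤ p) {e f : EdgeIndex n}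
    (hef : e ≠ f) :
    ∫ ω, (A ω e.1.1 e.1.2 - A ω f.1.1 f.1.2) ^ 2 ∂μ = 2 * p * (1 - p) := by
  have h := (hA.indep_edges.indepFun hef).integral_sq_sub_eq
    (hA.measurable_entry _ _) (hA.measurable_entry _ _)
    (fun ω => (hA.isAdjMatrix ω).zero_or_one _ _) (fun ω => (hA.isAdjMatrix ω).zero_or_one _ _)
  refine h.trans ?_
  rw [hA.integral_edge hp, hA.integral_edge hp]
  ring

lemma iIndepFun_edge_pair (hA : IsErdosRenyi μ A p) (hY : IsErdosRenyi μ Y q)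
    (hAY : IndepFun (fun ω i j => A ω i j) (fun ω i j => Y ω i j) μ) :
    iIndepFun (fun (e : EdgeIndex n) ω => (A ω e.1.1 e.1.2, Y ω e.1.1 e.1.2)) μ := by
  refine hA.indep_edges.prodMk_of_indepFun hY.indep_edges (fun e => hA.measurable_entry _ _)
    (fun e => hY.measurable_entry _ _) ?_
  exact hAY.comp (φ := fun (M : Fin n → Fin n → ℝ) (e : EdgeIndex n) => M e.1.1 e.1.2)
    (ψ := fun (M : Fin n → Fin n → ℝ) (e : EdgeIndex n) => M e.1.1 e.1.2) (by fun_prop) (by fun_prop)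

end IsErdosRenyi

/-- For `u = (A e, Y e)` and `v = (A f, Y f)` with entries in `{0, 1}`, the indicator of the event
that `A` differs at `e` and `f` whereas `Y` does not. -/
def flipIndicator (u v : ℝ × ℝ) : ℝ := (u.1 - v.1) ^ 2 * (1 - (u.2 - v.2) ^ 2)

lemma flipIndicator_eq_zero_or_one {u v : ℝ × ℝ} (h1 : u.1 = 0 ∨ u.1 = 1) (h2 : u.2 = 0 ∨ u.2 = 1)
    (h3 : v.1 = 0 ∨ v.1 = 1) (h4 : v.2 = 0 ∨ v.2 = 1) :
    flipIndicator u v = 0 ∨ flipIndicator u v = 1 := by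
  unfold flipIndicator
  rcases h1 with h1 | h1 <;> rcases h2 with h2 | h2 <;> rcases h3 with h3 | h3 <;>
    rcases h4 with h4 | h4 <;> norm_num [h1, h2, h3, h4]

/-- The number of ordered pairs `(i, j)` such that the permutation `σ` changes the entry of `A` at
`(i, j)` but not that of `Y`. -/
def flipCount (A Y : Matrix (Fin n) (Fin n) ℝ) (σ : Equiv.Perm (Fin n)) : ℝ :=
  ∑ i, ∑ j, flipIndicator (A i j, Y i j) (A (σ i) (σ j), Y (σ i) (σ j))

lemma flipIndicator_entry_mem_Icc (hA : IsErdosRenyi μ A p) (hY : IsErdosRenyi μ Y q) (ω : Ω)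
    (i j k l : Fin n) :
    flipIndicator (A ω i j, Y ω i j) (A ω k l, Y ω k l) ∈ Set.Icc (0 : ℝ) 1 := by
  rcases flipIndicator_eq_zero_or_one (u := (A ω i j, Y ω i j)) (v := (A ω k l, Y ω k l))
    ((hA.isAdjMatrix ω).zero_or_one _ _) ((hY.isAdjMatrix ω).zero_or_one _ _)
    ((hA.isAdjMatrix ω).zero_or_one _ _) ((hY.isAdjMatrix ω).zero_or_one _ _) with h | h <;>
    simp [h]

/-- By independence the mean is 2p(1 - p)(1 - 2q(1 - q)), and 2q(1 - q) ≤ 1/2. -/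
lemma le_integral_flipIndicator [IsProbabilityMeasure μ] (hA : IsErdosRenyi μ A p) (hY : IsErdosRenyi μ Y q)
    (hAY : IndepFun (fun ω i j => A ω i j) (fun ω i j => Y ω i j) μ)
    (hp : p ∈ Set.Ioo (0 : ℝ) 1) (hq : q ∈ Set.Ioo (0 : ℝ) 1) {e f : EdgeIndex n} (hef : e ≠ f) :
    p * (1 - p) ≤ ∫ ω, flipIndicator (A ω e.1.1 e.1.2, Y ω e.1.1 e.1.2)
      (A ω f.1.1 f.1.2, Y ω f.1.1 f.1.2) ∂μ := by
  have hind : IndepFun (fun ω => (A ω e.1.1 e.1.2 - A ω f.1.1 f.1.2) ^ 2)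
      (fun ω => 1 - (Y ω e.1.1 e.1.2 - Y ω f.1.1 f.1.2) ^ 2) μ :=
    hAY.comp (φ := fun M : Fin n → Fin n → ℝ => (M e.1.1 e.1.2 - M f.1.1 f.1.2) ^ 2)
      (ψ := fun M : Fin n → Fin n → ℝ => 1 - (M e.1.1 e.1.2 - M f.1.1 f.1.2) ^ 2)
      (by fun_prop) (by fun_prop)
  have iA := integrable_sq_sub (μ := μ) (hA.measurable_entry e.1.1 e.1.2)
    (hA.measurable_entry f.1.1 f.1.2)
    (fun ω => (hA.isAdjMatrix ω).zero_or_one _ _) (fun ω => (hA.isAdjMatrix ω).zero_or_one _ _)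
  have iY := integrable_sq_sub (μ := μ) (hY.measurable_entry e.1.1 e.1.2)
    (hY.measurable_entry f.1.1 f.1.2)
    (fun ω => (hY.isAdjMatrix ω).zero_or_one _ _) (fun ω => (hY.isAdjMatrix ω).zero_or_one _ _)
  refine le_of_le_of_eq ?_ (hind.integral_fun_mul_eq_mul_integral
    iA.aestronglyMeasurable ((integrable_const 1).sub iY).aestronglyMeasurable).symm
  rw [hA.integral_sq_sub_edge hp.1.le hef, (integral_sub (integrable_const 1) iY :),
    hY.integral_sq_sub_edge hq.1.le hef]
  simp only [integral_const, probReal_univ, smul_eq_mul, one_mul]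
  have h1 : 0 ≤ p * (1 - p) := mul_nonneg hp.1.le (by linarith [hp.2])
  nlinarith [mul_nonneg h1 (sq_nonneg (2 * q - 1))]

lemma prob_flipCount_le [IsProbabilityMeasure μ] (hA : IsErdosRenyi μ A p) (hY : IsErdosRenyi μ Y q)
    (hAY : IndepFun (fun ω i j => A ω i j) (fun ω i j => Y ω i j) μ)
    (hp : p ∈ Set.Ioo (0 : ℝ) 1) (hq : q ∈ Set.Ioo (0 : ℝ) 1) (hn : 15 ≤ n)
    (σ : Equiv.Perm (Fin n)) :
    μ.real {ω | flipCount (A ω) (Y ω) σ ≤ p * (1 - p) * (σ.support.card * n) / 72} ≤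
      Real.exp (-(p * (1 - p) * (σ.support.card * n) / 72)) := by
  obtain ⟨U, J, hU, hJ, hcard⟩ := exists_many_disjoint_pairs hn σ
  have hne : ∀ x : {x // x ∈ U ×ˢ J}, x.1.1 ≠ x.1.2 := by
    rintro ⟨⟨x, y⟩, hx⟩ h
    rw [Finset.mem_product] at hx
    exact (hJ _ hx.2).1 (h ▸ hx.1)
  let a : {x // x ∈ U ×ˢ J} → EdgeIndex n := fun x => edgeIndex x.1.1 x.1.2 (hne x)
  let b : {x // x ∈ U ×ˢ J} → EdgeIndex n :=
    fun x => edgeIndex (σ x.1.1) (σ x.1.2) (σ.injective.ne (hne x))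
  have hswap : ∀ x y : {x // x ∈ U ×ˢ J}, ¬ (x.1.1 = y.1.2 ∧ x.1.2 = y.1.1) := by
    rintro ⟨⟨x, y⟩, hx⟩ ⟨⟨x', y'⟩, hx'⟩ ⟨h, -⟩
    rw [Finset.mem_product] at hx hx'
    exact (hJ _ hx'.2).1 (h ▸ hx.1)
  have ha : a.Injective := by
    intro x y hxy
    rcases (edgeIndex_eq_iff _ _).1 hxy with h | h
    · exact Subtype.ext (Prod.ext h.1 h.2)
    · exact (hswap x y h).elim
  have hb : b.Injective := by
    intro x y hxy
    rcases (edgeIndex_eq_iff _ _).1 hxy with h | h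
    · exact Subtype.ext (Prod.ext (σ.injective h.1) (σ.injective h.2))
    · exact (hswap x y ⟨σ.injective h.1, σ.injective h.2⟩).elim
  -- An edge from U × J has an endpoint in U, whereas both endpoints of an image edge avoid U.
  have hab : ∀ x y, a x ≠ b y := by
    rintro ⟨⟨x, y⟩, hx⟩ ⟨⟨x', y'⟩, hx'⟩ hxy
    rw [Finset.mem_product] at hx hx'
    rcases (edgeIndex_eq_iff _ _).1 hxy with h | h
    · exact hU _ hx'.1 (h.1 ▸ hx.1)
    · exact (hJ _ hx'.2).2 (h.1 ▸ hx.1)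
  have mA := hA.measurable_entry
  have mY := hY.measurable_entry
  have hW := (hA.iIndepFun_edge_pair hY hAY).prodMk_precomp
    (fun e => (mA e.1.1 e.1.2).prodMk (mY e.1.1 e.1.2)) ha hb hab
  have hF : Measurable fun w : (ℝ × ℝ) × (ℝ × ℝ) => flipIndicator w.1 w.2 := by
    unfold flipIndicator; fun_prop
  have hX := hW.comp (fun _ w => flipIndicator w.1 w.2) (fun _ => hF)
  have hr : 0 ≤ p * (1 - p) := mul_nonneg hp.1.le (by linarith [hp.2])
  have hmain := measureReal_sum_le_le_exp hX
    (fun x => hF.comp (((mA _ _).prodMk (mY _ _)).prodMk ((mA _ _).prodMk (mY _ _))))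
    (fun x ω => flipIndicator_entry_mem_Icc hA hY ω _ _ _ _) Finset.univ (r := p * (1 - p))
    (fun x _ => le_integral_flipIndicator hA hY hAY hp hq (hab x x))
  simp only [Finset.card_univ, Fintype.card_coe, Finset.card_product, Nat.cast_mul] at hmain
  have hcard' : (σ.support.card : ℝ) * n ≤ 18 * (U.card * J.card) := by exact_mod_cast hcard
  -- The constant is 72 = 4 · 18, from the Chernoff bound and the count of pairs.
  have hle : p * (1 - p) * (σ.support.card * n) / 72 ≤ p * (1 - p) * (U.card * J.card) / 4 := by
    nlinarith [mul_le_mul_of_nonneg_left hcard' hr]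
  refine (measureReal_mono ?_).trans (hmain.trans ?_)
  · intro ω hω
    have hω' : flipCount (A ω) (Y ω) σ ≤ p * (1 - p) * (σ.support.card * n) / 72 := hω
    refine le_trans (le_trans ?_ hω') hle
    have hA' := hA.isAdjMatrix ω
    have hY' := hY.isAdjMatrix ω
    calc _ = ∑ x : {x // x ∈ U ×ˢ J}, flipIndicator (A ω x.1.1 x.1.2, Y ω x.1.1 x.1.2)
          (A ω (σ x.1.1) (σ x.1.2), Y ω (σ x.1.1) (σ x.1.2)) := by
          refine Finset.sum_congr rfl fun x _ => ?_
          refine congr_arg₂ flipIndicator (Prod.ext ?_ ?_) (Prod.ext ?_ ?_)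
          · exact hA'.apply_edgeIndex _ _ _
          · exact hY'.apply_edgeIndex _ _ _
          · exact hA'.apply_edgeIndex _ _ _
          · exact hY'.apply_edgeIndex _ _ _
      _ = ∑ x ∈ U ×ˢ J, flipIndicator (A ω x.1 x.2, Y ω x.1 x.2)
          (A ω (σ x.1) (σ x.2), Y ω (σ x.1) (σ x.2)) :=
          Finset.sum_coe_sort (U ×ˢ J) fun x => flipIndicator (A ω x.1 x.2, Y ω x.1 x.2)
            (A ω (σ x.1) (σ x.2), Y ω (σ x.1) (σ x.2))
      _ ≤ ∑ x ∈ Finset.univ ×ˢ Finset.univ, flipIndicator (A ω x.1 x.2, Y ω x.1 x.2)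
          (A ω (σ x.1) (σ x.2), Y ω (σ x.1) (σ x.2)) :=
          Finset.sum_le_sum_of_subset_of_nonneg (by simp)
            fun x _ _ => (flipIndicator_entry_mem_Icc hA hY ω _ _ _ _).1
      _ = flipCount (A ω) (Y ω) σ := Finset.sum_product _ _ _
  · rw [Real.exp_le_exp]
    linarith

/-- With high probability, no permutation but the identity has a small `flipCount`. -/
lemma prob_exists_flipCount_le [IsProbabilityMeasure μ] (hA : IsErdosRenyi μ A p)
    (hY : IsErdosRenyi μ Y q)
    (hAY : IndepFun (fun ω i j => A ω i j) (fun ω i j => Y ω i j) μ)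
    (hp : p ∈ Set.Ioo (0 : ℝ) 1) (hq : q ∈ Set.Ioo (0 : ℝ) 1) (hn : 15 ≤ n)
    (hlog : 216 * Real.log n ≤ p * (1 - p) * n) :
    μ.real {ω | ∃ σ : Equiv.Perm (Fin n), σ ≠ 1 ∧
      flipCount (A ω) (Y ω) σ ≤ p * (1 - p) * (σ.support.card * n) / 72} ≤
        Real.exp (1 / n) - 1 := by
  have hn0 : (0 : ℝ) < n := by positivity
  set x : ℝ := Real.exp (-(3 * Real.log n)) with hx
  have hx3 : x = ((n : ℝ) ^ 3)⁻¹ := by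
    rw [hx, Real.exp_neg, show 3 * Real.log n = Real.log ((n : ℝ) ^ 3) by
      rw [Real.log_pow]; norm_num, Real.exp_log (by positivity)]
  have hset : {ω | ∃ σ : Equiv.Perm (Fin n), σ ≠ 1 ∧
      flipCount (A ω) (Y ω) σ ≤ p * (1 - p) * (σ.support.card * n) / 72} =
      ⋃ σ ∈ (Finset.univ.erase 1 : Finset (Equiv.Perm (Fin n))),
        {ω | flipCount (A ω) (Y ω) σ ≤ p * (1 - p) * (σ.support.card * n) / 72} := by
    ext ω; simp
  rw [hset]
  refine (measureReal_biUnion_finset_le _ _).trans ?_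
  -- Since 216 = 3 · 72, each moved label contributes a factor x = n⁻³ to the failure probability;
  -- the identity accounts for the term 1 subtracted next.
  calc _ ≤ ∑ σ ∈ (Finset.univ.erase 1 : Finset (Equiv.Perm (Fin n))), x ^ σ.support.card := by
        refine Finset.sum_le_sum fun σ _ => (prob_flipCount_le hA hY hAY hp hq hn σ).trans ?_
        rw [hx, ← Real.exp_nat_mul, Real.exp_le_exp]
        nlinarith [mul_le_mul_of_nonneg_left hlog (Nat.cast_nonneg (α := ℝ) σ.support.card)]
    _ = ∑ σ : Equiv.Perm (Fin n), x ^ σ.support.card - 1 := by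
        rw [← Finset.add_sum_erase _ _ (Finset.mem_univ (1 : Equiv.Perm (Fin n)))]
        simp
    _ ≤ (1 + n * x) ^ n - 1 := by
        have := sum_perm_pow_card_support_le (α := Fin n) (x := x) (Real.exp_pos _).le
        rw [Fintype.card_fin] at this
        linarith
    _ ≤ Real.exp (n * x) ^ n - 1 := by
        have h0 : 0 ≤ x := (Real.exp_pos _).le
        have : 1 + n * x ≤ Real.exp (n * x) := by linarith [Real.add_one_le_exp (n * x)]
        gcongr
    _ = Real.exp (1 / n) - 1 := by
        rw [← Real.exp_nat_mul, hx3]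
        congr 2
        field_simp

/-- With high probability, no row sum of the matrix of edge probabilities is large. -/
lemma prob_exists_le_sum_edgeProb [IsProbabilityMeasure μ] (hA : IsErdosRenyi μ A p)
    (hY : IsErdosRenyi μ Y q)
    (hAY : IndepFun (fun ω i j => A ω i j) (fun ω i j => Y ω i j) μ)
    (hp : 0 ≤ p) (hq : 0 ≤ q) {θ₀ θ₁ θ₂ : ℝ}
    (hθ : ∀ a ∈ ({0, 1} : Set ℝ), ∀ b ∈ ({0, 1} : Set ℝ), θ₀ + θ₁ * a + θ₂ * b ∈ Set.Icc (0 : ℝ) 1)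
    (hm : 0 ≤ θ₀ + θ₁ * p + θ₂ * q) (b : ℝ) :
    μ.real {ω | ∃ i, b ≤ ∑ j, edgeProb θ₀ θ₁ θ₂ (A ω) (Y ω) i j} ≤
      n * Real.exp (2 * (n * (θ₀ + θ₁ * p + θ₂ * q)) - b) := by
  rw [Set.ofPred_exists]
  refine (measureReal_iUnion_fintype_le _).trans ?_
  suffices h : ∀ i, μ.real {ω | b ≤ ∑ j, edgeProb θ₀ θ₁ θ₂ (A ω) (Y ω) i j} ≤
      Real.exp (2 * (n * (θ₀ + θ₁ * p + θ₂ * q)) - b) by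
    simpa using Finset.sum_le_sum fun i (_ : i ∈ Finset.univ) => h i
  intro i
  let a : {j // i ≠ j} → EdgeIndex n := fun j => edgeIndex i j j.2
  have ha : a.Injective := by
    rintro ⟨j, hj⟩ ⟨k, hk⟩ h
    rcases (edgeIndex_eq_iff _ _).1 h with h | h
    · exact Subtype.ext h.2
    · exact (hk h.1).elim
  have hF : Measurable fun w : ℝ × ℝ => θ₀ + θ₁ * w.1 + θ₂ * w.2 := by fun_prop
  have hX := ((hA.iIndepFun_edge_pair hY hAY).precomp ha).comp
    (fun _ w => θ₀ + θ₁ * w.1 + θ₂ * w.2) fun _ => hF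
  have hmain := measureReal_le_sum_le_exp hX
    (fun x => hF.comp ((hA.measurable_entry _ _).prodMk (hY.measurable_entry _ _)))
    (fun x ω => hθ _ ((hA.isAdjMatrix ω).zero_or_one _ _) _ ((hY.isAdjMatrix ω).zero_or_one _ _))
    Finset.univ (M := n * (θ₀ + θ₁ * p + θ₂ * q)) ?_ b
  · refine le_of_eq_of_le ?_ hmain
    congr 1
    ext ω
    have hsum : ∑ j, edgeProb θ₀ θ₁ θ₂ (A ω) (Y ω) i j =
        ∑ j : {j // i ≠ j}, (θ₀ + θ₁ * A ω i j + θ₂ * Y ω i j) := by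
      rw [← Finset.sum_subtype (Finset.univ.filter (i ≠ ·)) (by simp)
        fun j => θ₀ + θ₁ * A ω i j + θ₂ * Y ω i j, Finset.sum_filter]
      exact Finset.sum_congr rfl fun j _ => by simp [edgeProb]
    change b ≤ _ ↔ b ≤ _
    rw [hsum]
    refine iff_of_eq (congr_arg (b ≤ ·) (Finset.sum_congr rfl fun j _ => ?_))
    have h1 := (hA.isAdjMatrix ω).apply_edgeIndex i j j.2
    have h2 := (hY.isAdjMatrix ω).apply_edgeIndex i j j.2
    rw [← h1, ← h2]
    rfl
  · have hint : ∀ e : EdgeIndex n, ∫ ω, (θ₀ + θ₁ * A ω e.1.1 e.1.2 + θ₂ * Y ω e.1.1 e.1.2) ∂μ =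
        θ₀ + θ₁ * p + θ₂ * q := by
      intro e
      have iA := (hA.integrable_entry e.1.1 e.1.2).const_mul θ₁
      have iY := (hY.integrable_entry e.1.1 e.1.2).const_mul θ₂
      refine (integral_add ((integrable_const θ₀).add iA) iY).trans ?_
      refine congr_arg₂ (· + ·) ((integral_add (integrable_const θ₀) iA).trans ?_) ?_
      · rw [integral_const_mul, hA.integral_edge hp]; simp
      · rw [integral_const_mul, hY.integral_edge hq]
    -- A row has fewer than n off-diagonal entries, each of mean m; rounding up to n needs m ≥ 0.
    refine (Finset.sum_congr rfl fun j _ => hint (a j)).trans_le ?_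
    rw [Finset.sum_const, nsmul_eq_mul]
    refine mul_le_mul_of_nonneg_right ?_ hm
    have := Fintype.card_subtype_le (fun j => i ≠ j)
    rw [Fintype.card_fin] at this
    simpa only [Finset.card_univ] using (Nat.cast_le (α := ℝ)).2 this

end ErdosRenyi

/-! ### Deterministic bounds on the mismatch -/

section Mismatch

variable {n : ℕ}

lemma movedLabels_permMatrix (σ : Equiv.Perm (Fin n)) :
    movedLabels (σ.permMatrix ℝ) = σ.support := by
  ext i
  simp [movedLabels, PEquiv.toMatrix_apply, eq_comm]

open scoped Matrix Matrix.Norms.Frobenius in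
lemma mismatch_permMatrix (P : Matrix (Fin n) (Fin n) ℝ) (σ : Equiv.Perm (Fin n)) :
    mismatch P (σ.permMatrix ℝ) = ∑ i, ∑ j, (P i j - P (σ i) (σ j)) ^ 2 := by
  have hconj : σ.permMatrix ℝ * P * (σ.permMatrix ℝ)ᵀ = P.submatrix σ σ := by
    rw [Matrix.transpose_permMatrix, PEquiv.toMatrix_toPEquiv_mul, PEquiv.mul_toMatrix_toPEquiv]
    rfl
  have h0 : 0 ≤ ∑ i, ∑ j, (P i j - P (σ i) (σ j)) ^ 2 :=
    Finset.sum_nonneg fun i _ => Finset.sum_nonneg fun j _ => sq_nonneg _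
  rw [mismatch, hconj, Matrix.frobenius_norm_def, ← Real.sqrt_eq_rpow]
  simp only [Matrix.sub_apply, Matrix.submatrix_apply, Real.norm_eq_abs, Real.rpow_ofNat, sq_abs]
  exact Real.sq_sqrt h0

variable {A Y : Matrix (Fin n) (Fin n) ℝ} {θ₀ θ₁ θ₂ : ℝ}

lemma edgeProb_symm (hA : A.IsAdjMatrix) (hY : Y.IsAdjMatrix) (i j : Fin n) :
    edgeProb θ₀ θ₁ θ₂ A Y i j = edgeProb θ₀ θ₁ θ₂ A Y j i := by
  simp [edgeProb, hA.symm.apply i j, hY.symm.apply i j, eq_comm]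

lemma edgeProb_nonneg (hA : A.IsAdjMatrix) (hY : Y.IsAdjMatrix)
    (hθ : ∀ a ∈ ({0, 1} : Set ℝ), ∀ b ∈ ({0, 1} : Set ℝ), θ₀ + θ₁ * a + θ₂ * b ∈ Set.Icc (0 : ℝ) 1)
    (i j : Fin n) : 0 ≤ edgeProb θ₀ θ₁ θ₂ A Y i j := by
  simp only [edgeProb, Matrix.of_apply]
  split_ifs
  · rfl
  · exact (hθ _ (hA.zero_or_one i j) _ (hY.zero_or_one i j)).1

lemma edgeProb_comm (i j : Fin n) : edgeProb θ₀ θ₂ θ₁ Y A i j = edgeProb θ₀ θ₁ θ₂ A Y i j := by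
  simp only [edgeProb, Matrix.of_apply]
  split_ifs <;> ring

/-- Where A flips and Y does not, the entry of P changes by exactly ±θ₁; all other squares are only
bounded below by 0. -/
lemma sq_mul_flipCount_le_mismatch (hA : A.IsAdjMatrix) (hY : Y.IsAdjMatrix)
    (σ : Equiv.Perm (Fin n)) :
    θ₁ ^ 2 * flipCount A Y σ ≤ mismatch (edgeProb θ₀ θ₁ θ₂ A Y) (σ.permMatrix ℝ) := by
  rw [mismatch_permMatrix, flipCount, Finset.mul_sum]
  refine Finset.sum_le_sum fun i _ => ?_
  rw [Finset.mul_sum]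
  refine Finset.sum_le_sum fun j _ => ?_
  rcases eq_or_ne i j with rfl | h
  · simp [flipIndicator, hA.apply_diag, sq_nonneg]
  · have h' : σ i ≠ σ j := σ.injective.ne h
    simp only [edgeProb, Matrix.of_apply, if_neg h, if_neg h', flipIndicator]
    rcases hA.zero_or_one i j with h1 | h1 <;> rcases hY.zero_or_one i j with h2 | h2 <;>
      rcases hA.zero_or_one (σ i) (σ j) with h3 | h3 <;>
      rcases hY.zero_or_one (σ i) (σ j) with h4 | h4 <;> rw [h1, h2, h3, h4] <;> ring_nf <;>
      nlinarith [sq_nonneg θ₁, sq_nonneg θ₂, sq_nonneg (θ₁ + θ₂), sq_nonneg (θ₁ - θ₂)]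

/-- Each pair is charged to its moved endpoints. A pair with two moved endpoints is charged twice,
which is harmless since the entries are nonnegative. -/
lemma sum_movedPairs_le {P : Matrix (Fin n) (Fin n) ℝ} (hsymm : ∀ i j, P i j = P j i)
    (h0 : ∀ i j, 0 ≤ P i j) (Q : Matrix (Fin n) (Fin n) ℝ) :
    ∑ e ∈ movedPairs Q, P e.1 e.2 ≤ ∑ i ∈ movedLabels Q, ∑ j, P i j := by
  classical
  have h1 : ∑ e ∈ movedPairs Q, P e.1 e.2 ≤
      (∑ i, ∑ j, if i ∈ movedLabels Q ∧ j < i then P i j else 0) +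
        ∑ i, ∑ j, if j ∈ movedLabels Q ∧ j < i then P i j else 0 := by
    rw [movedPairs, Finset.sum_filter, ← Finset.univ_product_univ, Finset.sum_product,
      ← Finset.sum_add_distrib]
    refine Finset.sum_le_sum fun i _ => ?_
    rw [← Finset.sum_add_distrib]
    refine Finset.sum_le_sum fun j _ => ?_
    have := h0 i j
    by_cases hi : i ∈ movedLabels Q <;> by_cases hj : j ∈ movedLabels Q <;>
      by_cases hij : j < i <;> simp [hi, hj, hij, this]
  refine h1.trans ?_
  rw [Finset.sum_comm (s := Finset.univ) (t := Finset.univ)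
    (f := fun i j => if j ∈ movedLabels Q ∧ j < i then P i j else 0), ← Finset.sum_add_distrib,
    ← Finset.sum_filter_add_sum_filter_not Finset.univ (· ∈ movedLabels Q)]
  have h2 : ∀ i ∈ Finset.univ.filter (fun i => ¬ i ∈ movedLabels Q),
      ((∑ j, if i ∈ movedLabels Q ∧ j < i then P i j else 0) +
        ∑ j, if i ∈ movedLabels Q ∧ i < j then P j i else 0) = 0 := by
    intro i hi
    simp [(Finset.mem_filter.1 hi).2]
  rw [Finset.sum_eq_zero h2, add_zero, Finset.filter_univ_mem]
  refine Finset.sum_le_sum fun i hi => ?_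
  rw [← Finset.sum_add_distrib]
  refine Finset.sum_le_sum fun j _ => ?_
  rw [hsymm j i]
  -- The first sum charges P i j to row i only if j < i, the second only if i < j, so no entry of a
  -- row is used twice.
  rcases lt_trichotomy i j with h | h | h
  · simp [hi, h, h.not_gt]
  · simp [h, h0]
  · simp [hi, h, h.not_gt]

lemma signalCondition_of_flipCount {S : Finset (Fin n)} {d τ m α₃ C : ℝ} (hn : 2 ≤ n)
    (hd : 0 < d) (hτ : 0 < τ) (hα₃ : 0 < α₃) (hC : 1 ≤ C) (hS : S.Nonempty)
    (hA : A.IsAdjMatrix) (hY : Y.IsAdjMatrix)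
    (hθ : ∀ a ∈ ({0, 1} : Set ℝ), ∀ b ∈ ({0, 1} : Set ℝ), θ₀ + θ₁ * a + θ₂ * b ∈ Set.Icc (0 : ℝ) 1)
    (hsig : α₃ * max (Real.log n / (τ * n))
      (√(Real.log S.card) * m / (τ ^ (3 / 2 : ℝ) * S.card)) ≤ θ₁ ^ 2 + θ₂ ^ 2)
    (hflip : ∀ σ : Equiv.Perm (Fin n), σ ≠ 1 →
      d * τ * (σ.support.card * n) / 144 ≤ flipCount A Y σ ∧
      d * τ * (σ.support.card * n) / 144 ≤ flipCount Y A σ)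
    (hrow : ∀ i, ∑ j, edgeProb θ₀ θ₁ θ₂ A Y i j ≤ C * (n * m)) :
    SignalCondition (d / (288 * C) * α₃) τ S (edgeProb θ₀ θ₁ θ₂ A Y) := by
  intro σ _
  have hn0 : (0 : ℝ) < n := by positivity
  have hs : (0 : ℝ) < S.card := by exact_mod_cast hS.card_pos
  set P := edgeProb θ₀ θ₁ θ₂ A Y with hP
  rw [movedLabels_permMatrix]
  set k : ℝ := (σ.support.card : ℝ) with hk
  have hk0 : 0 ≤ k := Nat.cast_nonneg _
  have hM : d / 288 * (k * τ * n) * (θ₁ ^ 2 + θ₂ ^ 2) ≤ mismatch P (σ.permMatrix ℝ) := by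
    rcases eq_or_ne σ 1 with rfl | h1
    · have : k = 0 := by simp [hk]
      simp only [this, zero_mul, mul_zero]
      rw [mismatch]
      exact sq_nonneg _
    · obtain ⟨hf, hf'⟩ := hflip σ h1
      have h2 := sq_mul_flipCount_le_mismatch (θ₀ := θ₀) (θ₁ := θ₁) (θ₂ := θ₂) hA hY σ
      have h3 := sq_mul_flipCount_le_mismatch (θ₀ := θ₀) (θ₁ := θ₂) (θ₂ := θ₁) hY hA σ
      rw [show edgeProb θ₀ θ₂ θ₁ Y A = P from Matrix.ext edgeProb_comm] at h3
      -- Both lower bounds concern the same mismatch; their average turns 144 into 288.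
      have h4 := mul_le_mul_of_nonneg_left hf (sq_nonneg θ₁)
      have h5 := mul_le_mul_of_nonneg_left hf' (sq_nonneg θ₂)
      linarith
  have hsum : ∑ e ∈ movedPairs (σ.permMatrix ℝ), P e.1 e.2 ≤ k * (C * (n * m)) := by
    refine (sum_movedPairs_le (edgeProb_symm hA hY) (edgeProb_nonneg hA hY hθ) _).trans ?_
    rw [movedLabels_permMatrix, hk, ← nsmul_eq_mul]
    exact Finset.sum_le_card_nsmul _ _ _ fun i _ => hrow i
  have hC0 : 0 < C := by linarith
  have hsτ : 0 < √τ := Real.sqrt_pos.2 hτ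
  have hpow : τ ^ (3 / 2 : ℝ) = τ * √τ := by
    rw [Real.sqrt_eq_rpow, show (3 / 2 : ℝ) = 1 + 1 / 2 by norm_num, Real.rpow_add hτ,
      Real.rpow_one]
  rw [hpow] at hsig
  set B : ℝ := max (Real.log n / (τ * n)) (√(Real.log S.card) * m / (τ * √τ * S.card)) with hB
  have hw : 0 ≤ k * τ * n := by positivity
  have hlog : 0 ≤ Real.log n := Real.log_natCast_nonneg n
  -- Pulling out kτn turns the two terms of the signal condition into the two terms of (iii), at the
  -- cost of the factor C.
  have hmax : max (k * Real.log n) (√(Real.log S.card) / (√τ * S.card) *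
      ∑ e ∈ movedPairs (σ.permMatrix ℝ), P e.1 e.2) ≤ C * (k * τ * n) * B := by
    refine max_le ?_ ?_
    · have h1 : k * Real.log n = k * τ * n * (Real.log n / (τ * n)) := by field_simp
      rw [h1, mul_assoc C]
      have h2 : k * τ * n * (Real.log n / (τ * n)) ≤ k * τ * n * B :=
        mul_le_mul_of_nonneg_left (le_max_left _ _) hw
      have h3 : 0 ≤ k * τ * n * (Real.log n / (τ * n)) := by positivity
      nlinarith
    · calc _ ≤ √(Real.log S.card) / (√τ * S.card) * (k * (C * (n * m))) :=
            mul_le_mul_of_nonneg_left hsum (by positivity)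
        _ = C * (k * τ * n) * (√(Real.log S.card) * m / (τ * √τ * S.card)) := by field_simp
        _ ≤ _ := mul_le_mul_of_nonneg_left (le_max_right _ _) (by positivity)
  calc _ ≤ d / (288 * C) * α₃ * (C * (k * τ * n) * B) :=
        mul_le_mul_of_nonneg_left hmax (by positivity)
    _ = d / 288 * (k * τ * n) * (α₃ * B) := by field_simp
    _ ≤ d / 288 * (k * τ * n) * (θ₁ ^ 2 + θ₂ ^ 2) :=
        mul_le_mul_of_nonneg_left hsig (by positivity)
    _ ≤ _ := hM

end Mismatch

/-! ### Assembly of the probability bounds -/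

section Main

/-- One of p and 1 - p is at least 1/2, and the other is at least min(1, δ) t. -/
lemma half_min_one_mul_le {δ p t : ℝ} (hp : p ∈ Set.Ioo (0 : ℝ) 1) (ht : 0 < t)
    (htp : t ≤ p) (hpδ : p ≤ 1 - δ * t) : min 1 δ * t / 2 ≤ p * (1 - p) := by
  rcases le_total p (1 / 2) with h | h
  · have := mul_le_mul_of_nonneg_right (min_le_left 1 δ) ht.le
    nlinarith [hp.1]
  · have := mul_le_mul_of_nonneg_right (min_le_right 1 δ) ht.le
    nlinarith [hp.2]

/-- The signal condition fails with a probability that vanishes in the size of the graphs. -/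
lemma prob_not_signalCondition_le {Ω : Type*} [MeasurableSpace Ω] {μ : Measure Ω}
    [IsProbabilityMeasure μ] {n : ℕ} {A Y : Ω → Matrix (Fin n) (Fin n) ℝ}
    {p q θ₀ θ₁ θ₂ τ m δ α₁ α₃ : ℝ} {S : Finset (Fin n)} (hn : 15 ≤ n) (hδ : 0 < δ) (hα₁ : 0 < α₁)
    (hα₃ : 0 < α₃) (hp : p ∈ Set.Ioo (0 : ℝ) 1) (hq : q ∈ Set.Ioo (0 : ℝ) 1)
    (hA : IsErdosRenyi μ A p) (hY : IsErdosRenyi μ Y q)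
    (hAY : IndepFun (fun ω i j => A ω i j) (fun ω i j => Y ω i j) μ)
    (hθ : ∀ a ∈ ({0, 1} : Set ℝ), ∀ b ∈ ({0, 1} : Set ℝ), θ₀ + θ₁ * a + θ₂ * b ∈ Set.Icc (0 : ℝ) 1)
    (hS : S.Nonempty) (hτ : τ = min p q) (hm : m = θ₀ + θ₁ * p + θ₂ * q)
    (hpδ : p ≤ 1 - δ * τ) (hqδ : q ≤ 1 - δ * τ) (hm1 : α₁ * (Real.log n / n) ≤ m)
    (hτ1 : 216 / min 1 δ * (Real.log n / n) ≤ τ ^ 2 / (p + q))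
    (hsig : α₃ * max (Real.log n / (τ * n))
      (√(Real.log S.card) * m / (τ ^ (3 / 2 : ℝ) * S.card)) ≤ θ₁ ^ 2 + θ₂ ^ 2) :
    μ.real {ω | ¬ SignalCondition (min 1 δ / (288 * (2 + 2 / α₁)) * α₃) τ S
      (edgeProb θ₀ θ₁ θ₂ (A ω) (Y ω))} ≤ 2 * (Real.exp (1 / n) - 1) + 1 / n := by
  have hn0 : (0 : ℝ) < n := by positivity
  set d := min 1 δ with hd
  have hd0 : 0 < d := lt_min one_pos hδ
  have hτp : τ ≤ p := hτ ▸ min_le_left _ _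
  have hτq : τ ≤ q := hτ ▸ min_le_right _ _
  have hτ0 : 0 < τ := hτ ▸ lt_min hp.1 hq.1
  have hlog : 0 ≤ Real.log n := Real.log_natCast_nonneg n
  have hm0 : 0 ≤ m := le_trans (by positivity) hm1
  have hrp : d * τ / 2 ≤ p * (1 - p) := half_min_one_mul_le hp hτ0 hτp hpδ
  have hrq : d * τ / 2 ≤ q * (1 - q) := half_min_one_mul_le hq hτ0 hτq hqδ
  have hτn : 216 * Real.log n ≤ d * τ / 2 * n := by
    -- As p + q ≥ 2τ, condition (ii) with the constant 216 / d gives the density needed for the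
    -- union bound over permutations.
    have h1 : τ ^ 2 / (p + q) ≤ τ / 2 := by
      rw [div_le_div_iff₀ (by linarith) two_pos]
      nlinarith
    have h2 := hτ1.trans h1
    rw [div_mul_div_comm, div_le_div_iff₀ (by positivity) two_pos] at h2
    linarith
  have hnn : (0 : ℝ) ≤ n := hn0.le
  have hb1 := prob_exists_flipCount_le hA hY hAY hp hq hn
    (hτn.trans (mul_le_mul_of_nonneg_right hrp hnn))
  have hb2 := prob_exists_flipCount_le hY hA hAY.symm hq hp hn
    (hτn.trans (mul_le_mul_of_nonneg_right hrq hnn))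
  have hb3 := prob_exists_le_sum_edgeProb hA hY hAY hp.1.le hq.1.le hθ (hm ▸ hm0)
    ((2 + 2 / α₁) * (n * m))
  rw [← hm] at hb3
  have hrow : n * Real.exp (2 * (n * m) - (2 + 2 / α₁) * (n * m)) ≤ 1 / (n : ℝ) := by
    -- The summand 2 in C absorbs the mean term of the Chernoff bound, and 2/α₁ leaves n⁻² for each
    -- row by (i).
    have h1 : 2 * (n * m) - (2 + 2 / α₁) * (n * m) ≤ -(2 * Real.log n) := by
      have h2 : Real.log n ≤ n * m / α₁ := by
        rw [le_div_iff₀ hα₁]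
        have := mul_le_mul_of_nonneg_left hm1 hnn
        rwa [show n * (α₁ * (Real.log n / n)) = Real.log n * α₁ by field_simp] at this
      have h3 : 2 / α₁ * (n * m) = 2 * (n * m / α₁) := by ring
      linarith
    calc _ ≤ n * Real.exp (-(2 * Real.log n)) := by gcongr
      _ = 1 / (n : ℝ) := by
        rw [Real.exp_neg, show 2 * Real.log n = Real.log ((n : ℝ) ^ 2) by
          rw [Real.log_pow]; norm_num, Real.exp_log (by positivity)]
        field_simp
  have hsub : {ω | ¬ SignalCondition (d / (288 * (2 + 2 / α₁)) * α₃) τ S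
      (edgeProb θ₀ θ₁ θ₂ (A ω) (Y ω))} ⊆
      ({ω | ∃ σ : Equiv.Perm (Fin n), σ ≠ 1 ∧
        flipCount (A ω) (Y ω) σ ≤ p * (1 - p) * (σ.support.card * n) / 72} ∪
      {ω | ∃ σ : Equiv.Perm (Fin n), σ ≠ 1 ∧
        flipCount (Y ω) (A ω) σ ≤ q * (1 - q) * (σ.support.card * n) / 72}) ∪
      {ω | ∃ i, (2 + 2 / α₁) * (n * m) ≤ ∑ j, edgeProb θ₀ θ₁ θ₂ (A ω) (Y ω) i j} := by
    intro ω hω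
    by_contra hcon
    simp only [Set.mem_union, Set.mem_ofPred_eq, not_or, not_exists, not_and, not_le] at hcon hω
    obtain ⟨⟨h1, h2⟩, h3⟩ := hcon
    refine hω (signalCondition_of_flipCount (by omega) hd0 hτ0 hα₃ ?_ hS (hA.isAdjMatrix ω)
      (hY.isAdjMatrix ω) hθ hsig (fun σ hσ => ⟨?_, ?_⟩) fun i => (h3 i).le)
    · have : 0 < 2 / α₁ := by positivity
      linarith
    · have := mul_le_mul_of_nonneg_right hrp (show (0 : ℝ) ≤ σ.support.card * n by positivity)
      linarith [h1 σ hσ]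
    · have := mul_le_mul_of_nonneg_right hrq (show (0 : ℝ) ≤ σ.support.card * n by positivity)
      linarith [h2 σ hσ]
  have h1 := measureReal_mono hsub (μ := μ)
  have h2 := measureReal_union_le (μ := μ)
    ({ω | ∃ σ : Equiv.Perm (Fin n), σ ≠ 1 ∧
        flipCount (A ω) (Y ω) σ ≤ p * (1 - p) * (σ.support.card * n) / 72} ∪
      {ω | ∃ σ : Equiv.Perm (Fin n), σ ≠ 1 ∧
        flipCount (Y ω) (A ω) σ ≤ q * (1 - q) * (σ.support.card * n) / 72})
      {ω | ∃ i, (2 + 2 / α₁) * (n * m) ≤ ∑ j, edgeProb θ₀ θ₁ θ₂ (A ω) (Y ω) i j}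
  have h3 := measureReal_union_le (μ := μ) {ω | ∃ σ : Equiv.Perm (Fin n), σ ≠ 1 ∧
        flipCount (A ω) (Y ω) σ ≤ p * (1 - p) * (σ.support.card * n) / 72}
      {ω | ∃ σ : Equiv.Perm (Fin n), σ ≠ 1 ∧
        flipCount (Y ω) (A ω) σ ≤ q * (1 - q) * (σ.support.card * n) / 72}
  linarith

/-- Subadditivity over an event and its complement suffices, so the events need not be measurable.
-/
lemma tendsto_measure_of_compl_le {Ω : ℕ → Type*} [∀ n, MeasurableSpace (Ω n)]
    {μ : ∀ n, Measure (Ω n)} [∀ n, IsProbabilityMeasure (μ n)] {E : ∀ n, Set (Ω n)} {ε : ℕ → ℝ}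
    (hε : Tendsto ε atTop (𝓝 0)) (h : ∀ᶠ n in atTop, (μ n).real (E n)ᶜ ≤ ε n) :
    Tendsto (fun n => μ n (E n)) atTop (𝓝 1) := by
  have hlow : Tendsto (fun n => ENNReal.ofReal (1 - ε n)) atTop (𝓝 1) := by
    have h1 : Tendsto (fun n => 1 - ε n) atTop (𝓝 1) := by
      simpa using tendsto_const_nhds.sub hε
    simpa using ENNReal.tendsto_ofReal h1
  refine tendsto_of_tendsto_of_tendsto_of_le_of_le' hlow tendsto_const_nhds ?_
    (Eventually.of_forall fun n => prob_le_one)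
  filter_upwards [h] with n hn
  rw [ENNReal.ofReal_le_iff_le_toReal (measure_ne_top _ _)]
  have h1 := measureReal_union_le (μ := μ n) (E n) (E n)ᶜ
  rw [Set.union_compl_self, probReal_univ] at h1
  change 1 - ε n ≤ (μ n).real (E n)
  linarith

end Main

end

theorem proposition3 :
    ∀ δ : ℝ, 0 < δ → ∃ α₂ : ℝ, 0 < α₂ ∧
      ∀ α₁ : ℝ, 0 < α₁ → ∃ c : ℝ, 0 < c ∧ ∀ α₃ : ℝ, 0 < α₃ →
      ∀ (Ω : ℕ → Type*) [∀ n, MeasurableSpace (Ω n)]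
        (μ : ∀ n, Measure (Ω n)) [∀ n, IsProbabilityMeasure (μ n)]
        (p q θ₀ θ₁ θ₂ τ m : ℕ → ℝ) (S : ∀ n, Finset (Fin n))
        (A Y : ∀ n, Ω n → Matrix (Fin n) (Fin n) ℝ),
        -- the model
        (∀ n, p n ∈ Set.Ioo (0 : ℝ) 1) → (∀ n, q n ∈ Set.Ioo (0 : ℝ) 1) →
        (∀ n, IsErdosRenyi (μ n) (A n) (p n)) →
        (∀ n, IsErdosRenyi (μ n) (Y n) (q n)) →
        (∀ n, IndepFun (fun ω i j => A n ω i j) (fun ω i j => Y n ω i j) (μ n)) →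
        (∀ᶠ n in atTop, ∀ a ∈ ({0, 1} : Set ℝ), ∀ b ∈ ({0, 1} : Set ℝ),
          θ₀ n + θ₁ n * a + θ₂ n * b ∈ Set.Icc (0 : ℝ) 1) →
        (∀ᶠ n in atTop, (S n).Nonempty) →
        -- the smaller of the two densities, and the mean edge probability of the second graph
        (∀ n, τ n = min (p n) (q n)) →
        (∀ n, m n = θ₀ n + θ₁ n * p n + θ₂ n * q n) →
        -- both densities lie in `[τ n, 1 - δ * τ n]`
        (∀ᶠ n in atTop, p n ≤ 1 - δ * τ n ∧ q n ≤ 1 - δ * τ n) →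
        -- the conditions (i), (ii), (iii)
        (∀ᶠ n : ℕ in atTop, α₁ * (Real.log n / n) ≤ m n) →
        (∀ᶠ n : ℕ in atTop, α₂ * (Real.log n / n) ≤ τ n ^ 2 / (p n + q n)) →
        (∀ᶠ n : ℕ in atTop,
          α₃ * max (Real.log n / (τ n * n))
              (√(Real.log (S n).card) * m n / (τ n ^ (3 / 2 : ℝ) * (S n).card))
            ≤ θ₁ n ^ 2 + θ₂ n ^ 2) →
        Tendsto
          (fun n => μ n {ω | SignalCondition (c * α₃) (τ n) (S n)
            (edgeProb (θ₀ n) (θ₁ n) (θ₂ n) (A n ω) (Y n ω))})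
          atTop (𝓝 1) := by
  intro δ hδ
  have hd : 0 < min 1 δ := lt_min one_pos hδ
  refine ⟨216 / min 1 δ, by positivity, fun α₁ hα₁ =>
    ⟨min 1 δ / (288 * (2 + 2 / α₁)), by positivity, ?_⟩⟩
  intro α₃ hα₃ Ω _ μ _ p q θ₀ θ₁ θ₂ τ m S A Y hp hq hA hY hAY hθ hS hτ hm hδτ hm1 hτ1 hsig
  have hε : Tendsto (fun n : ℕ => 2 * (Real.exp (1 / n) - 1) + 1 / (n : ℝ)) atTop (𝓝 0) := by
    have h1 : Tendsto (fun n : ℕ => 1 / (n : ℝ)) atTop (𝓝 0) := tendsto_one_div_atTop_nhds_zero_nat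
    have h2 := (((Real.continuous_exp.tendsto 0).comp h1).sub_const 1).const_mul 2 |>.add h1
    simpa using h2
  refine tendsto_measure_of_compl_le hε ?_
  filter_upwards [eventually_ge_atTop 15, hθ, hS, hδτ, hm1, hτ1, hsig] with
    n hn hθ hS hδτ hm1 hτ1 hsig
  exact prob_not_signalCondition_le hn hδ hα₁ hα₃ (hp n) (hq n) (hA n) (hY n) (hAY n) hθ hS
    (hτ n) (hm n) hδτ.1 hδτ.2 hm1 hτ1 hsig
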